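/- Let $p\ge 1$ and $q\ge 2$ be integers, put $d=p+q$, and let $Q:\mathbb{Z}^{d}\to\mathbb{Z}$ be the quadratic form $Q(x_1,\dots,x_p,y_1,\dots,y_q)=x_1^2+\cdots+x_p^2-y_1^2-\cdots-y_q^2$. Let $SO(Q)(\mathbb{Z})$ denote the group of all $\gamma\in SL_{d}(\mathbb{Z})$ with $Q\circ\gamma=Q$; a matrix $\gamma$ is called unipotent if $\gamma-I$ is nilpotent. Then the following hold. (1) There is a subgroup $\Gamma\le SO(Q)(\mathbb{Z})$ that is generated by a finite set of unipotent matrices and whose linear action on $\mathbb{R}^{d}$ is irreducible, i.e. the only $\Gamma$-invariant linear subspaces of $\mathbb{R}^d$ are $\{0\}$ and $\mathbb{R}^d$. (2) For every set $B\subset\mathbb{Z}^{d}$ of positive upper Banach density, i.e. with $$d^*(B)=\limsup_{R\to\infty}\ \sup_{x\in\mathbb{Z}^{d}}\frac{|B\cap(x+[0,R)^{d})|}{R^{d}}>0,$$ the set $Q(B-B)=\{Q(b-b') : b,b'\in B\}$ contains a nontrivial subgroup of $\mathbb{Z}$, i.e. there is an integer $k\ge 1$ with $k\mathbb{Z}\subset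 Q(B-B)$. -/

import Mathlib

open Filter
open scoped ENNReal Pointwise Matrix

/-- The set of integer points of the half-open cube `x + [0, R)^ι`. -/
def intCube {ι : Type*} (x : ι → ℤ) (R : ℝ) : Set (ι → ℤ) :=
  {v | ∀ i, (x i : ℝ) ≤ (v i : ℝ) ∧ (v i : ℝ) < (x i : ℝ) + R}

/-- The upper Banach density of `B ⊆ ℤ^ι`, where `d = |ι|`:
`limsup_{R → ∞} sup_{x ∈ ℤ^ι} |B ∩ (x + [0, R)^ι)| / R^d`.
It is computed in `[0, ∞]`, so that neither the supremum nor the upper limit has a junk value. -/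
noncomputable def upperBanachDensity {ι : Type*} [Fintype ι] (B : Set (ι → ℤ)) : ℝ≥0∞ :=
  limsup (fun R : ℝ =>
    ⨆ x : ι → ℤ, ((B ∩ intCube x R).encard : ℝ≥0∞) / ENNReal.ofReal R ^ Fintype.card ι) atTop

/-- The quadratic form `x₁² + ⋯ + x_p² - y₁² - ⋯ - y_q²` on `ℤ^(p+q)`; the coordinates `x` are
indexed by `Fin p` and the coordinates `y` by `Fin q`. -/
def stdForm (p q : ℕ) : QuadraticForm ℤ (Fin p ⊕ Fin q → ℤ) :=
  QuadraticMap.weightedSumSquares ℤ (Sum.elim (fun _ => (1 : ℤ)) (fun _ => (-1 : ℤ)))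

theorem stdForm_apply (p q : ℕ) (v : Fin p ⊕ Fin q → ℤ) :
    stdForm p q v = ∑ i, v (Sum.inl i) ^ 2 - ∑ j, v (Sum.inr j) ^ 2 := by
  simp [stdForm, QuadraticMap.weightedSumSquares_apply, Fintype.sum_sum_type, sq, sub_eq_add_neg]

/-- The integral special orthogonal group `SO(Q)(ℤ)`: the matrices `γ` in `SL_d(ℤ)` with
`Q ∘ γ = Q`. -/
def integralSO {ι : Type*} [Fintype ι] [DecidableEq ι] (Q : QuadraticForm ℤ (ι → ℤ)) :
    Subgroup (Matrix.SpecialLinearGroup ι ℤ) where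
  carrier := {γ | ∀ v : ι → ℤ, Q ((γ : Matrix ι ι ℤ) *ᵥ v) = Q v}
  one_mem' := by
    intro v
    simp
  mul_mem' := by
    intro a b ha hb v
    rw [Matrix.SpecialLinearGroup.coe_mul, ← Matrix.mulVec_mulVec, ha, hb]
  inv_mem' := by
    intro a ha v
    rw [← ha, Matrix.mulVec_mulVec, ← Matrix.SpecialLinearGroup.coe_mul, mul_inv_cancel]
    simp

/-- A matrix `γ` is unipotent if `γ - 1` is nilpotent. -/
def IsUnipotentMatrix {ι : Type*} [Fintype ι] [DecidableEq ι] (γ : Matrix.SpecialLinearGroup ι ℤ) : Prop :=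
  IsNilpotent ((γ : Matrix ι ι ℤ) - 1)

/-- The linear action of a subgroup `Γ` of `SL_d(ℤ)` on `ℝ^d` by matrix-vector multiplication. -/
noncomputable def realRep {ι : Type*} [Fintype ι] [DecidableEq ι]
    (Γ : Subgroup (Matrix.SpecialLinearGroup ι ℤ)) : Representation ℝ Γ (ι → ℝ) where
  toFun γ := Matrix.mulVecLin (((γ : Matrix.SpecialLinearGroup ι ℤ) : Matrix ι ι ℤ).map (Int.cast : ℤ → ℝ))
  map_one' := by
    have h : (1 : Matrix ι ι ℤ).map (Int.cast : ℤ → ℝ) = 1 :=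
      Matrix.map_one _ Int.cast_zero Int.cast_one
    simp only [OneMemClass.coe_one, Matrix.SpecialLinearGroup.coe_one, h, Matrix.mulVecLin_one]
    rfl
  map_mul' a b := by
    have h (M N : Matrix ι ι ℤ) : (M * N).map (Int.cast : ℤ → ℝ) =
        M.map (Int.cast : ℤ → ℝ) * N.map (Int.cast : ℤ → ℝ) :=
      Matrix.map_mul (f := Int.castRingHom ℝ)
    simp only [Subgroup.coe_mul, Matrix.SpecialLinearGroup.coe_mul, h, Matrix.mulVecLin_mul]
    rfl

/-! Part (1): for an isotropic vector `e = x_i ± y_j` and another basis vector `g`, the Eichler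
transvection `1 + N` is integral, preserves `Q` and satisfies `N ^ 3 = 0`. As `N ^ 2 v` is a
multiple of `e`, nonzero when `g` is a basis vector and `v` is not orthogonal to `e`, a nonzero
invariant subspace contains some `e`, then both signs, then every basis vector
(`isIrreducible_realRep_closure_eichlerSet`).

Part (2) is a recurrence argument. An invariant mean built on cubes in which `B` is dense turns `B`
into a vector `f` of a Hilbert space with an isometric action `T` of `ℤ^d`, such that `⟪f, T g f⟫ >
0` forces `g ∈ B - B`. It remains to find, for one `k` and every `n`, a `g` with `Q(g) = 4k²n` and
positive correlation.

The form `4(uv - w²)` sits inside `Q`, and the level set `uv - w² = n` contains the quadratic curves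
`a_s + t b_s + t² c_s` with `c_s = (s², s, 1)`. Split `f = f₀ + r`, with `f₀` the projection to the
closure of the vectors fixed by some `kG`, `k ≠ 0`. For suitable `k`, `f₀` is almost fixed by `kG`
and contributes a definite positive amount. By van der Corput's argument, the contribution of `r`
along the curve is somewhere not very negative, provided `r` is nearly orthogonal to the vectors
fixed by any nonzero multiple of `c_s` (`exists_neg_lt_inner_quadratic`). Some `s` has this
property: any three `c_s` span a subgroup of finite index, so `r` has no component fixed by
multiples of three of them, and a Bessel inequality allows only finitely many large projections
(`exists_norm_starProjection_le`). -/

/-- A family of operators `T g`, `g ∈ G`, is an isometric action of the additive group `G`. -/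
structure IsIsometricAction {G H : Type*} [AddCommGroup G] [NormedAddCommGroup H]
    [InnerProductSpace ℝ H] (T : G → H →L[ℝ] H) : Prop where
  map_zero : ∀ x, T 0 x = x
  map_add : ∀ g h x, T (g + h) x = T g (T h x)
  norm_map : ∀ g x, ‖T g x‖ = ‖x‖

/-! ### Bessel inequalities for commuting projections. -/

section Bessel

variable {H : Type*} [NormedAddCommGroup H] [InnerProductSpace ℝ H]

open scoped RealInnerProductSpace

/-- A Bessel inequality for almost orthogonal projections `u i` of the vector `r`. -/
theorem sq_sum_norm_sq_le {ι : Type*} [DecidableEq ι] (s : Finset ι) (r : H) (u : ι → H)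
    (hu : ∀ i ∈ s, ⟪r, u i⟫ = ‖u i‖ ^ 2) {Y : ℝ}
    (hY : ∑ i ∈ s, ∑ j ∈ s.erase i, ⟪u i, u j⟫ ≤ Y) :
    (∑ i ∈ s, ‖u i‖ ^ 2) ^ 2 ≤ ‖r‖ ^ 2 * (∑ i ∈ s, ‖u i‖ ^ 2 + Y) := by
  have h1 : ⟪r, ∑ i ∈ s, u i⟫ = ∑ i ∈ s, ‖u i‖ ^ 2 := by
    rw [inner_sum]; exact Finset.sum_congr rfl hu
  have h2 : ‖∑ i ∈ s, u i‖ ^ 2 ≤ ∑ i ∈ s, ‖u i‖ ^ 2 + Y := by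
    rw [← real_inner_self_eq_norm_sq, sum_inner]
    have : ∀ i ∈ s, ⟪u i, ∑ j ∈ s, u j⟫ = ‖u i‖ ^ 2 + ∑ j ∈ s.erase i, ⟪u i, u j⟫ := by
      intro i hi
      rw [inner_sum, ← Finset.add_sum_erase s _ hi, real_inner_self_eq_norm_sq]
    rw [Finset.sum_congr rfl this, Finset.sum_add_distrib]
    linarith
  rw [← h1]
  calc ⟪r, ∑ i ∈ s, u i⟫ ^ 2 ≤ (‖r‖ * ‖∑ i ∈ s, u i‖) ^ 2 := by
        apply sq_le_sq'
        · exact (abs_le.1 (abs_real_inner_le_norm _ _)).1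
        · exact real_inner_le_norm _ _
    _ = ‖r‖ ^ 2 * ‖∑ i ∈ s, u i‖ ^ 2 := by ring
    _ ≤ _ := by rw [h1]; gcongr

/-- If commuting orthogonal projections `P i` satisfy `P i (P j (P k r)) = 0` for distinct
`i, j, k`, then `∑ ‖P i r‖ ^ 2 ≤ 2 ‖r‖ ^ 2`. -/
theorem sum_norm_sq_le_two_mul {ι : Type*} [DecidableEq ι] (s : Finset ι) (r : H)
    (P : ι → H → H) (hsymm : ∀ i x y, ⟪P i x, y⟫ = ⟪x, P i y⟫) (hidem : ∀ i x, P i (P i x) = P i x)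
    (hcomm : ∀ i j x, P i (P j x) = P j (P i x))
    (h3 : ∀ i j k, i ≠ j → i ≠ k → j ≠ k → P i (P j (P k r)) = 0) :
    ∑ i ∈ s, ‖P i r‖ ^ 2 ≤ 2 * ‖r‖ ^ 2 := by
  have hself : ∀ i x, ⟪x, P i x⟫ = ‖P i x‖ ^ 2 := by
    intro i x
    rw [← real_inner_self_eq_norm_sq, hsymm, hidem]
  have key : ∀ X A : ℝ, 0 ≤ X → 0 ≤ A → X ^ 2 ≤ A * X → X ≤ A := by
    intro X A hX hA h
    by_contra! hlt
    nlinarith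
  -- For fixed `i` the vectors `P j (P i r)`, `j ≠ i`, are pairwise orthogonal, because their inner
  -- products are triple products; Bessel applies with no error term.
  have h4 : ∀ i ∈ s, ∑ j ∈ s.erase i, ‖P j (P i r)‖ ^ 2 ≤ ‖P i r‖ ^ 2 := by
    intro i _
    have := sq_sum_norm_sq_le (s.erase i) (P i r) (fun j => P j (P i r)) (Y := 0)
      (fun j _ => hself j _) (by
        refine le_of_eq (Finset.sum_eq_zero fun j hj => Finset.sum_eq_zero fun k hk => ?_)
        have hji := Finset.ne_of_mem_erase hj
        have hkj := Finset.ne_of_mem_erase hk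
        have hki := Finset.ne_of_mem_erase (Finset.mem_of_mem_erase hk)
        rw [hsymm, h3 j k i hkj.symm hji hki, inner_zero_right])
    rw [add_zero] at this
    exact key _ _ (by positivity) (by positivity) this
  -- Here `⟪P i r, P j r⟫ = ‖P j (P i r)‖ ^ 2`, so the off-diagonal total is at most the diagonal
  -- sum `X`, and `X ^ 2 ≤ ‖r‖ ^ 2 * (2 * X)`.
  have h5 := sq_sum_norm_sq_le s r (fun i => P i r) (Y := ∑ i ∈ s, ‖P i r‖ ^ 2)
    (fun i _ => hself i r) (by
      refine Finset.sum_le_sum fun i hi => le_trans (le_of_eq ?_) (h4 i hi)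
      refine Finset.sum_congr rfl fun j _ => ?_
      rw [← hself, hcomm j i, ← hsymm i, hidem])
  refine key _ _ (by positivity) (by positivity) ?_
  linarith

end Bessel

/-! ### Isometric actions, fixed vectors and rational vectors. -/

section Projection

variable {H : Type*} [NormedAddCommGroup H] [InnerProductSpace ℝ H]

open scoped RealInnerProductSpace

/-- An orthogonal projection commutes with every operator such that the operator and its adjoint
preserve the subspace. -/
theorem starProjection_apply_comm (K : Submodule ℝ H) [K.HasOrthogonalProjection] (A B : H → H)
    (hsub : ∀ x y, A (x - y) = A x - A y)
    (hAB : ∀ x y, ⟪A x, y⟫ = ⟪x, B y⟫) (hA : ∀ x ∈ K, A x ∈ K) (hB : ∀ x ∈ K, B x ∈ K) (x : H) :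
    K.starProjection (A x) = A (K.starProjection x) := by
  refine Submodule.eq_starProjection_of_mem_of_inner_eq_zero
    (hA _ (K.starProjection_apply_mem x)) fun w hw => ?_
  rw [← hsub, hAB]
  exact Submodule.starProjection_inner_eq_zero x _ (hB w hw)

variable {G : Type*} [AddCommGroup G]

/-- The vectors fixed by an operator. -/
abbrev fixedVectors (A : H →L[ℝ] H) : Submodule ℝ H :=
  A.eqLocus (1 : H →L[ℝ] H)

theorem mem_fixedVectors {A : H →L[ℝ] H} {x : H} : x ∈ fixedVectors A ↔ A x = x := by
  simp [LinearMap.mem_eqLocus]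

variable {T : G → H →L[ℝ] H}

namespace IsIsometricAction

theorem inner_map (hT : IsIsometricAction T) (g : G) (x y : H) : ⟪T g x, T g y⟫ = ⟪x, y⟫ := by
  have h1 := norm_add_sq_real (T g x) (T g y)
  have h2 := norm_add_sq_real x y
  rw [← _root_.map_add, hT.norm_map, hT.norm_map, hT.norm_map] at h1
  linarith

theorem map_comm (hT : IsIsometricAction T) (g h : G) (x : H) : T g (T h x) = T h (T g x) := by
  rw [← hT.map_add, ← hT.map_add, add_comm]

theorem inner_left (hT : IsIsometricAction T) (g : G) (x y : H) :
    ⟪T g x, y⟫ = ⟪x, T (-g) y⟫ := by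
  rw [← hT.inner_map (-g), ← hT.map_add, neg_add_cancel, hT.map_zero]

theorem inner_map_map (hT : IsIsometricAction T) (g h : G) (x y : H) :
    ⟪T g x, T h y⟫ = ⟪x, T (h - g) y⟫ := by
  rw [hT.inner_left, ← hT.map_add, neg_add_eq_sub]

theorem map_neg_eq (hT : IsIsometricAction T) {g : G} {x : H} (h : T g x = x) :
    T (-g) x = x := by
  conv_lhs => rw [← h]
  rw [← hT.map_add, neg_add_cancel, hT.map_zero]

theorem map_nsmul_eq_iterate (hT : IsIsometricAction T) (n : ℕ) (g : G) (x : H) :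
    T (n • g) x = (T g)^[n] x := by
  induction n with
  | zero => simp [hT.map_zero]
  | succ n ih => rw [succ_nsmul', hT.map_add, ih, Function.iterate_succ_apply']

theorem map_zsmul_eq (hT : IsIsometricAction T) {g : G} {x : H} (h : T g x = x) (n : ℤ) :
    T (n • g) x = x := by
  have hn : ∀ m : ℕ, T (m • g) x = x := by
    intro m
    rw [hT.map_nsmul_eq_iterate, Function.iterate_fixed h]
  obtain ⟨m, rfl | rfl⟩ := n.eq_nat_or_neg
  · rw [natCast_zsmul]; exact hn m
  · rw [neg_smul, natCast_zsmul]; exact hT.map_neg_eq (hn m)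

theorem starProjection_map (hT : IsIsometricAction T) (K : Submodule ℝ H)
    [K.HasOrthogonalProjection] (hK : ∀ g, ∀ x ∈ K, T g x ∈ K) (g : G) (x : H) :
    K.starProjection (T g x) = T g (K.starProjection x) :=
  starProjection_apply_comm K (T g) (T (-g)) (fun x y => map_sub _ x y) (hT.inner_left g)
    (hK g) (hK (-g)) x

theorem map_mem_fixedVectors (hT : IsIsometricAction T) (c g : G) (x : H)
    (hx : x ∈ fixedVectors (T c)) : T g x ∈ fixedVectors (T c) := by
  rw [mem_fixedVectors] at hx ⊢
  rw [hT.map_comm, hx]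

variable [CompleteSpace H]

theorem starProjection_fixedVectors_mem (hT : IsIsometricAction T) (c d : G) (x : H)
    (hx : x ∈ fixedVectors (T c)) :
    (fixedVectors (T d)).starProjection x ∈ fixedVectors (T c) := by
  rw [mem_fixedVectors] at hx ⊢
  rw [← hT.starProjection_map _ (hT.map_mem_fixedVectors d), hx]

/-- Since `G` is commutative, `T c` commutes with the projection to the vectors fixed by `T d`, so
this self-adjoint projection preserves the vectors fixed by `T c`. -/
theorem starProjection_fixedVectors_comm (hT : IsIsometricAction T) (c d : G) (x : H) :
    (fixedVectors (T c)).starProjection ((fixedVectors (T d)).starProjection x) =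
      (fixedVectors (T d)).starProjection ((fixedVectors (T c)).starProjection x) :=
  starProjection_apply_comm _ (fixedVectors (T d)).starProjection
    (fixedVectors (T d)).starProjection (fun x y => map_sub _ x y)
    (fun x y => Submodule.inner_starProjection_left_eq_right _ x y)
    (fun x hx => hT.starProjection_fixedVectors_mem c d x hx)
    (fun x hx => hT.starProjection_fixedVectors_mem c d x hx) x

/-- The mean ergodic theorem along the multiples of `g`. -/
theorem tendsto_average (hT : IsIsometricAction T) (g : G) (x y : H) :
    Tendsto (fun N : ℕ => (N : ℝ)⁻¹ * ∑ n ∈ Finset.range N, ⟪y, T (n • g) x⟫) atTop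
      (nhds ⟪y, (fixedVectors (T g)).starProjection x⟫) := by
  have h := (T g).tendsto_birkhoffAverage_orthogonalProjection
    ((T g).opNorm_le_bound zero_le_one fun x => by rw [hT.norm_map, one_mul]) x
  have h2 := h.inner (𝕜 := ℝ) (tendsto_const_nhds (x := y))
  simp only [birkhoffAverage, birkhoffSum, id] at h2
  refine (h2.congr fun N => ?_).trans (le_of_eq ?_)
  · rw [real_inner_smul_left, sum_inner]
    simp_rw [hT.map_nsmul_eq_iterate, real_inner_comm]
  · rw [real_inner_comm]; rfl

end IsIsometricAction

/-- The vectors that are fixed by a subgroup `k • G` with `k ≠ 0`. -/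
def rationalVectors (T : G → H →L[ℝ] H) : Submodule ℝ H where
  carrier := {x | ∃ k : ℤ, k ≠ 0 ∧ ∀ g, T (k • g) x = x}
  zero_mem' := ⟨1, one_ne_zero, fun g => map_zero _⟩
  add_mem' := by
    rintro x y ⟨k, hk, hx⟩ ⟨l, hl, hy⟩
    refine ⟨k * l, mul_ne_zero hk hl, fun g => ?_⟩
    rw [map_add, mul_smul, hx, ← mul_smul, mul_comm, mul_smul, hy]
  smul_mem' := by
    rintro a x ⟨k, hk, hx⟩
    exact ⟨k, hk, fun g => by rw [map_smul, hx]⟩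

theorem map_mem_rationalVectors (hT : IsIsometricAction T) (g : G) (x : H)
    (hx : x ∈ rationalVectors T) : T g x ∈ rationalVectors T := by
  obtain ⟨k, hk, hx⟩ := hx
  exact ⟨k, hk, fun h => by rw [hT.map_comm, hx]⟩

theorem map_mem_closure_rationalVectors (hT : IsIsometricAction T) (g : G) (x : H)
    (hx : x ∈ (rationalVectors T).topologicalClosure) :
    T g x ∈ (rationalVectors T).topologicalClosure :=
  map_mem_closure (T g).continuous hx fun y hy => map_mem_rationalVectors hT g y hy

variable [CompleteSpace H]

/-- A vector orthogonal to the rational vectors is nearly orthogonal to the vectors fixed by all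
multiples of one of the `c s`, as soon as any three of the `c s` span a subgroup of finite
index. -/
theorem exists_norm_starProjection_le (hT : IsIsometricAction T) {c : ℕ → G}
    (hc : ∀ i j l, i ≠ j → i ≠ l → j ≠ l → ∃ n : ℤ, n ≠ 0 ∧ ∀ g, ∃ α β γ : ℤ,
      n • g = α • c i + β • c j + γ • c l) {r : H} (hr : ∀ x ∈ rationalVectors T, ⟪r, x⟫ = 0)
    {η : ℝ} (hη : 0 < η) :
    ∃ s, ∀ m : ℤ, m ≠ 0 → ‖(fixedVectors (T (m • c s))).starProjection r‖ ≤ η := by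
  by_contra! hcon
  choose m hm hlt using hcon
  obtain ⟨S, hS⟩ := exists_nat_gt (2 * ‖r‖ ^ 2 / η ^ 2)
  -- A common multiple of the `m s`: fixed spaces only grow when `m s` is replaced by `M`, so all
  -- lower bounds survive with a single multiplier.
  set M : ℤ := ∏ s ∈ Finset.range S, m s with hMdef
  have hM : M ≠ 0 := Finset.prod_ne_zero_iff.2 fun s _ => hm s
  set P : ℕ → H → H := fun s x => (fixedVectors (T (M • c s))).starProjection x with hP
  have hcomm : ∀ i j x, P i (P j x) = P j (P i x) := fun i j x =>
    hT.starProjection_fixedVectors_comm _ _ x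
  have hfix : ∀ i x, T (M • c i) (P i x) = P i x := fun i x =>
    mem_fixedVectors.1 (Submodule.starProjection_apply_mem _ x)
  have hsymm : ∀ i x y, ⟪P i x, y⟫ = ⟪x, P i y⟫ := fun i x y =>
    Submodule.inner_starProjection_left_eq_right _ x y
  have h3 : ∀ i j k, i ≠ j → i ≠ k → j ≠ k → P i (P j (P k r)) = 0 := by
    intro i j l hij hil hjl
    -- The vector is fixed by `M • c i`, `M • c j` and `M • c l`, hence by `(M * n) • G`.
    have hrat : ∀ x, P i (P j (P l x)) ∈ rationalVectors T := by
      intro x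
      obtain ⟨n, hn, hg⟩ := hc i j l hij hil hjl
      refine ⟨M * n, mul_ne_zero hM hn, fun g => ?_⟩
      obtain ⟨α, β, γ, h⟩ := hg g
      have e : (M * n) • g = α • (M • c i) + (β • (M • c j) + γ • (M • c l)) := by
        rw [mul_smul, h]; module
      have hi := hT.map_zsmul_eq (hfix i (P j (P l x))) α
      have hj : T (β • (M • c j)) (P i (P j (P l x))) = P i (P j (P l x)) := by
        rw [hcomm i j]; exact hT.map_zsmul_eq (hfix j _) β
      have hl : T (γ • (M • c l)) (P i (P j (P l x))) = P i (P j (P l x)) := by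
        rw [hcomm j l, hcomm i l]; exact hT.map_zsmul_eq (hfix l _) γ
      rw [e, hT.map_add, hT.map_add, hl, hj, hi]
    refine ext_inner_right ℝ fun x => ?_
    rw [inner_zero_left, hsymm, hsymm, hsymm, hcomm j i, hcomm l i, hcomm l j]
    exact hr _ (hrat x)
  have hsum := sum_norm_sq_le_two_mul (Finset.range S) r P hsymm
    (fun i x => Submodule.starProjection_eq_self_iff.2 (Submodule.starProjection_apply_mem _ x))
    hcomm h3
  have hlow : ∀ s ∈ Finset.range S, η ^ 2 ≤ ‖P s r‖ ^ 2 := by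
    intro s hs
    have hle : fixedVectors (T (m s • c s)) ≤ fixedVectors (T (M • c s)) := by
      intro x hx
      obtain ⟨n, hn⟩ := Finset.dvd_prod_of_mem m hs
      rw [mem_fixedVectors] at hx ⊢
      rw [hMdef, hn, mul_comm, mul_smul]
      exact hT.map_zsmul_eq hx n
    have h1 : (fixedVectors (T (m s • c s))).starProjection r =
        (fixedVectors (T (m s • c s))).starProjection (P s r) := by
      simp only [hP]
      exact (DFunLike.congr_fun (Submodule.starProjection_comp_starProjection_of_le hle) r).symm
    have h2 : ‖(fixedVectors (T (m s • c s))).starProjection r‖ ≤ ‖P s r‖ := by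
      rw [h1]; exact Submodule.norm_starProjection_apply_le _ _
    exact pow_le_pow_left₀ hη.le ((hlt s).le.trans h2) 2
  have := Finset.sum_le_sum hlow
  rw [Finset.sum_const, Finset.card_range, nsmul_eq_mul] at this
  rw [div_lt_iff₀ (by positivity)] at hS
  linarith

end Projection

/-! ### Van der Corput's argument and quadratic recurrence. -/

section Recurrence

variable {H : Type*} [NormedAddCommGroup H] [InnerProductSpace ℝ H] [CompleteSpace H]
variable {G : Type*} [AddCommGroup G] {T : G → H →L[ℝ] H}

open scoped RealInnerProductSpace

/-- Van der Corput's argument: correlations along a quadratic sequence with leading coefficient `c`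
are not all very negative if `r` is nearly orthogonal to the vectors fixed by a multiple of `c`. -/
theorem exists_neg_lt_inner_quadratic (hT : IsIsometricAction T) {c : G} {r : H} {η ε : ℝ}
    (hη : ∀ m : ℤ, m ≠ 0 → ‖(fixedVectors (T (m • c))).starProjection r‖ ≤ η)
    (hε : 0 < ε) (hηε : ‖r‖ ^ 3 * η < ε ^ 2) {k : ℤ} (hk : k ≠ 0) (a b : G) :
    ∃ t : ℕ, -ε < ⟪r, T (k • (a + t • b + t ^ 2 • c)) r⟫ := by
  by_contra! hcon
  have hη0 : 0 ≤ η := (norm_nonneg _).trans (hη 1 one_ne_zero)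
  set u : ℕ → G := fun t => k • (a + t • b + t ^ 2 • c) with hu
  set w : ℕ → ℕ → G := fun h h' =>
    k • (((h' : ℤ) - h) • b + ((h' : ℤ) ^ 2 - (h : ℤ) ^ 2) • c) with hw
  set m : ℕ → ℕ → ℤ := fun h h' => 2 * k * ((h' : ℤ) - h) with hm
  set l : ℕ → ℕ → ℝ := fun h h' =>
    ⟪T (-w h h') r, (fixedVectors (T (m h h' • c))).starProjection r⟫ with hl
  -- The difference `u (t + h') - u (t + h) = t • (m h h' • c) + w h h'` is linear in `t`, so the
  -- mean ergodic theorem along multiples of `m h h' • c` gives the limit.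
  have hlim : ∀ h h', Tendsto (fun N : ℕ => (N : ℝ)⁻¹ * ∑ t ∈ Finset.range N,
      ⟪T (u (t + h)) r, T (u (t + h')) r⟫) atTop (nhds (l h h')) := by
    intro h h'
    refine (hT.tendsto_average (m h h' • c) r (T (-w h h') r)).congr fun N => ?_
    congr 1
    refine Finset.sum_congr rfl fun t _ => ?_
    rw [hT.inner_map_map, hT.inner_map_map]
    congr 3
    simp only [hu, hw, hm, ← natCast_zsmul]
    push_cast
    module
  have hbound : ∀ h h', l h h' ≤ ‖r‖ * η + if h = h' then ‖r‖ ^ 2 else 0 := by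
    intro h h'
    have h1 : l h h' ≤ ‖r‖ * ‖(fixedVectors (T (m h h' • c))).starProjection r‖ := by
      refine (real_inner_le_norm _ _).trans_eq ?_
      rw [hT.norm_map]
    split_ifs with heq
    · have h2 := Submodule.norm_starProjection_apply_le (fixedVectors (T (m h h' • c))) r
      nlinarith [norm_nonneg r, mul_nonneg (norm_nonneg r) hη0]
    · have hm0 : m h h' ≠ 0 := by
        simp only [hm]
        refine mul_ne_zero (mul_ne_zero two_ne_zero hk) ?_
        intro h0
        exact heq (by omega)
      have h2 := mul_le_mul_of_nonneg_left (hη _ hm0) (norm_nonneg r)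
      linarith
  -- Cauchy–Schwarz for `r` against a window of `S` consecutive terms, each of correlation at most
  -- `-ε` by assumption.
  have hpoint : ∀ (S t : ℕ), (ε * S) ^ 2 ≤ ‖r‖ ^ 2 * ∑ h ∈ Finset.range S, ∑ h' ∈ Finset.range S,
      ⟪T (u (t + h)) r, T (u (t + h')) r⟫ := by
    intro S t
    have h1 : ⟪r, ∑ h ∈ Finset.range S, T (u (t + h)) r⟫ ≤ -(ε * S) := by
      rw [inner_sum]
      refine (Finset.sum_le_sum fun h _ => hcon (t + h)).trans_eq ?_
      simp [mul_comm]
    have h2 := neg_le_of_abs_le (abs_real_inner_le_norm r (∑ h ∈ Finset.range S, T (u (t + h)) r))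
    have h3 : ε * S ≤ ‖r‖ * ‖∑ h ∈ Finset.range S, T (u (t + h)) r‖ := by linarith
    have h4 := pow_le_pow_left₀ (by positivity) h3 2
    rw [mul_pow ‖r‖, ← real_inner_self_eq_norm_sq (∑ h ∈ Finset.range S, T (u (t + h)) r),
      sum_inner] at h4
    simpa only [inner_sum] using h4
  have hlimit : ∀ S : ℕ, (ε * S) ^ 2 ≤ ‖r‖ ^ 2 * ∑ h ∈ Finset.range S, ∑ h' ∈ Finset.range S,
      l h h' := by
    intro S
    have ht : Tendsto (fun N : ℕ => ‖r‖ ^ 2 * ∑ h ∈ Finset.range S, ∑ h' ∈ Finset.range S,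
        ((N : ℝ)⁻¹ * ∑ t ∈ Finset.range N, ⟪T (u (t + h)) r, T (u (t + h')) r⟫)) atTop
        (nhds (‖r‖ ^ 2 * ∑ h ∈ Finset.range S, ∑ h' ∈ Finset.range S, l h h')) :=
      Tendsto.const_mul _ (tendsto_finsetSum _ fun h _ => tendsto_finsetSum _ fun h' _ => hlim h h')
    refine ge_of_tendsto ht ?_
    filter_upwards [eventually_gt_atTop 0] with N hN
    have hN' : (0 : ℝ) < N := Nat.cast_pos.2 hN
    have h1 := Finset.sum_le_sum fun t (_ : t ∈ Finset.range N) => hpoint S t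
    rw [Finset.sum_const, Finset.card_range, nsmul_eq_mul, ← Finset.mul_sum,
      Finset.sum_comm] at h1
    simp_rw [← Finset.mul_sum]
    rw [mul_left_comm, le_inv_mul_iff₀ hN']
    refine h1.trans_eq ?_
    congr 1
    exact Finset.sum_congr rfl fun h _ => Finset.sum_comm
  have hfinal : ∀ S : ℕ, (ε * S) ^ 2 ≤ ‖r‖ ^ 2 * (S * (S * (‖r‖ * η) + ‖r‖ ^ 2)) := by
    intro S
    refine (hlimit S).trans (mul_le_mul_of_nonneg_left ?_ (by positivity))
    have : ∀ h ∈ Finset.range S, ∑ h' ∈ Finset.range S, l h h' ≤ S * (‖r‖ * η) + ‖r‖ ^ 2 := by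
      intro h hh
      refine (Finset.sum_le_sum fun h' _ => hbound h h').trans_eq ?_
      rw [Finset.sum_add_distrib, Finset.sum_ite_eq, if_pos hh]
      simp
    refine (Finset.sum_le_sum this).trans_eq ?_
    simp [mul_add]
  -- In `hfinal` the diagonal is linear in `S`, while the quadratic terms compare `ε ^ 2` with the
  -- smaller `‖r‖ ^ 3 * η`; this `S` makes the inequality fail.
  obtain ⟨S, hS⟩ := exists_nat_gt (‖r‖ ^ 4 / (ε ^ 2 - ‖r‖ ^ 3 * η))
  have hpos : 0 < ε ^ 2 - ‖r‖ ^ 3 * η := sub_pos.2 hηε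
  have hS0 : (0 : ℝ) < S := lt_of_le_of_lt (by positivity) hS
  rw [div_lt_iff₀ hpos] at hS
  have h1 := hfinal S
  have h2 : (ε ^ 2 * S) * S ≤ (‖r‖ ^ 4 + ‖r‖ ^ 3 * η * S) * S := by nlinarith
  have h3 := le_of_mul_le_mul_right h2 hS0
  nlinarith

/-- Quadratic recurrence for an isometric action: if any three of the `c s` span a subgroup of
finite index and `f` has nonzero mean, then there are positive correlations along quadratic
sequences with leading coefficients `c s`, after a dilation independent of the sequences. -/
theorem exists_pos_inner_quadratic (hT : IsIsometricAction T) {c : ℕ → G}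
    (hc : ∀ i j l, i ≠ j → i ≠ l → j ≠ l → ∃ n : ℤ, n ≠ 0 ∧ ∀ g, ∃ α β γ : ℤ,
      n • g = α • c i + β • c j + γ • c l)
    {f e : H} (he : ∀ g, T g e = e) (hfe : ⟪f, e⟫ ≠ 0) :
    ∃ k : ℤ, k ≠ 0 ∧ ∀ a b : ℕ → G, ∃ s t : ℕ,
      0 < ⟪f, T (k • (a s + t • b s + t ^ 2 • c s)) f⟫ := by
  set K := (rationalVectors T).topologicalClosure with hK
  have : CompleteSpace K := (rationalVectors T).isClosed_topologicalClosure.completeSpace_coe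
  set f₀ := K.starProjection f with hf₀
  set r := f - f₀ with hr
  have hf₀K : f₀ ∈ K := Submodule.starProjection_apply_mem _ _
  have hrK : ∀ x ∈ K, ⟪r, x⟫ = 0 := fun x hx => Submodule.starProjection_inner_eq_zero f x hx
  have heK : e ∈ K := subset_closure ⟨1, one_ne_zero, fun g => he _⟩
  have hpos : 0 < ‖f₀‖ := by
    refine norm_pos_iff.2 fun h0 => hfe ?_
    have := hrK e heK
    rwa [hr, h0, sub_zero] at this
  -- A quarter of `‖f₀‖` suffices: exchanging `f₀` for the fixed vector `g` costs two errors, each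
  -- at most `‖f₀‖ ^ 2 / 4`.
  obtain ⟨g, ⟨k, hk, hgk⟩, hdist⟩ := Metric.mem_closure_iff.1 hf₀K (‖f₀‖ / 4) (by positivity)
  rw [dist_eq_norm] at hdist
  have hmain : ∀ v, ‖f₀‖ ^ 2 / 2 ≤ ⟪f₀, T (k • v) f₀⟫ := by
    intro v
    have h1 : ⟪f₀, T (k • v) f₀⟫ = ‖f₀‖ ^ 2 + ⟪f₀, T (k • v) (f₀ - g)⟫ - ⟪f₀, f₀ - g⟫ := by
      rw [map_sub, hgk, inner_sub_right, inner_sub_right, real_inner_self_eq_norm_sq]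
      ring
    have h2 := neg_le_of_abs_le (abs_real_inner_le_norm f₀ (T (k • v) (f₀ - g)))
    have h3 := real_inner_le_norm f₀ (f₀ - g)
    rw [hT.norm_map] at h2
    nlinarith
  set ε := ‖f₀‖ ^ 2 / 2 with hε
  have hε0 : 0 < ε := by positivity
  set η := ε ^ 2 / (‖r‖ ^ 3 + 1) with hη
  have hη0 : 0 < η := by positivity
  have hηε : ‖r‖ ^ 3 * η < ε ^ 2 := by
    rw [hη, mul_div_assoc', div_lt_iff₀ (by positivity)]
    nlinarith [sq_pos_of_pos hε0]
  obtain ⟨s, hs⟩ := exists_norm_starProjection_le hT hc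
    (fun x hx => hrK x (subset_closure hx)) hη0
  refine ⟨k, hk, fun a b => ⟨s, ?_⟩⟩
  obtain ⟨t, ht⟩ := exists_neg_lt_inner_quadratic hT hs hε0 hηε hk (a s) (b s)
  refine ⟨t, ?_⟩
  set v := a s + t • b s + t ^ 2 • c s
  have hsplit : f = f₀ + r := by rw [hr]; abel
  have hx1 : ⟪f₀, T (k • v) r⟫ = 0 := by
    rw [real_inner_comm, hT.inner_left]
    exact hrK _ (map_mem_closure_rationalVectors hT _ _ hf₀K)
  have hx2 : ⟪r, T (k • v) f₀⟫ = 0 :=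
    hrK _ (map_mem_closure_rationalVectors hT _ _ hf₀K)
  have hx3 := hmain v
  rw [hsplit, map_add, inner_add_left, inner_add_right, inner_add_right, hx1, hx2]
  linarith

end Recurrence

/-! ### Invariant means and their Hilbert spaces. -/

section Mean

open scoped BoundedContinuousFunction RealInnerProductSpace

variable {G : Type*} [TopologicalSpace G]

/-- The average of a function over a finite set. -/
noncomputable def finsetAverage (s : Finset G) (φ : G →ᵇ ℝ) : ℝ :=
  (s.card : ℝ)⁻¹ * ∑ x ∈ s, φ x

theorem abs_finsetAverage_le (s : Finset G) (φ : G →ᵇ ℝ) : |finsetAverage s φ| ≤ ‖φ‖ := by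
  rw [finsetAverage, abs_mul, abs_of_nonneg (by positivity)]
  have h : |∑ x ∈ s, φ x| ≤ s.card * ‖φ‖ :=
    (Finset.abs_sum_le_sum_abs _ _).trans
      ((Finset.sum_le_sum fun x _ => φ.norm_coe_le_norm x).trans_eq (by simp))
  rcases s.eq_empty_or_nonempty with rfl | hs
  · simp
  · rw [inv_mul_le_iff₀ (by exact_mod_cast hs.card_pos)]
    exact h

variable [AddCommGroup G] [DiscreteTopology G]

/-- The translateFun `x ↦ φ (x + g)` of a bounded function. -/
def translateFun (g : G) (φ : G →ᵇ ℝ) : G →ᵇ ℝ :=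
  φ.compContinuous ⟨fun x => x + g, continuous_of_discreteTopology⟩

@[simp]
theorem translateFun_apply (g : G) (φ : G →ᵇ ℝ) (x : G) : translateFun g φ x = φ (x + g) := rfl

variable (G) in
/-- A positive functional on the bounded functions that is invariant under translations. -/
structure InvariantMean where
  /-- The functional. -/
  toLinearMap : (G →ᵇ ℝ) →ₗ[ℝ] ℝ
  mul_self_nonneg : ∀ φ, 0 ≤ toLinearMap (φ * φ)
  map_translateFun : ∀ g φ, toLinearMap (translateFun g φ) = toLinearMap φ

namespace InvariantMean

set_option linter.unusedVariables false in
/-- The bounded functions with the semi-inner product `⟪φ, ψ⟫ = M (φ * ψ)`. -/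
def PreSpace (M : InvariantMean G) := G →ᵇ ℝ

variable (M : InvariantMean G)

noncomputable instance : AddCommGroup M.PreSpace := inferInstanceAs (AddCommGroup (G →ᵇ ℝ))
noncomputable instance : Module ℝ M.PreSpace := inferInstanceAs (Module ℝ (G →ᵇ ℝ))

/-- A bounded function as an element of the pre-Hilbert space of the mean. -/
noncomputable def toPre : (G →ᵇ ℝ) ≃ₗ[ℝ] M.PreSpace := LinearEquiv.refl ℝ _

/-- The semi-inner product `⟪φ, ψ⟫ = M (φ * ψ)`. -/
noncomputable abbrev core : PreInnerProductSpace.Core ℝ M.PreSpace where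
  inner φ ψ := M.toLinearMap (M.toPre.symm φ * M.toPre.symm ψ)
  conj_inner_symm φ ψ := by simp [mul_comm]
  re_inner_nonneg φ := by simpa using M.mul_self_nonneg _
  add_left φ ψ χ := by rw [map_add, add_mul, map_add]
  smul_left φ ψ a := by rw [map_smul, smul_mul_assoc, map_smul]; simp

noncomputable instance : SeminormedAddCommGroup M.PreSpace :=
  InnerProductSpace.Core.toSeminormedAddCommGroup (c := M.core)

noncomputable instance : InnerProductSpace ℝ M.PreSpace :=
  InnerProductSpace.ofCore M.core

theorem inner_toPre (φ ψ : G →ᵇ ℝ) : ⟪M.toPre φ, M.toPre ψ⟫ = M.toLinearMap (φ * ψ) := rfl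

/-- The Hilbert space of an invariant mean. -/
abbrev Space := UniformSpace.Completion M.PreSpace

/-- Translation by `g` as a linear map. -/
noncomputable def translatePre (g : G) : M.PreSpace →ₗ[ℝ] M.PreSpace where
  toFun φ := M.toPre (translateFun g (M.toPre.symm φ))
  map_add' _ _ := rfl
  map_smul' _ _ := rfl

theorem norm_translatePre (g : G) (φ : M.PreSpace) : ‖M.translatePre g φ‖ = ‖φ‖ := by
  have h : ‖M.translatePre g φ‖ ^ 2 = ‖φ‖ ^ 2 := by
    rw [← real_inner_self_eq_norm_sq, ← real_inner_self_eq_norm_sq]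
    exact M.map_translateFun g (M.toPre.symm φ * M.toPre.symm φ)
  exact (sq_eq_sq₀ (norm_nonneg _) (norm_nonneg _)).1 h

/-- The action of `G` by translations on the Hilbert space of an invariant mean. -/
noncomputable def action (g : G) : M.Space →L[ℝ] M.Space :=
  ((M.translatePre g).mkContinuous 1 fun φ => by rw [norm_translatePre, one_mul]).completion

theorem action_coe (g : G) (φ : G →ᵇ ℝ) :
    M.action g (M.toPre φ : M.Space) = (M.toPre (translateFun g φ) : M.Space) := by
  simp only [action, ContinuousLinearMap.completion_apply_coe]
  rfl

theorem isIsometricAction_action : IsIsometricAction M.action where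
  map_zero x := by
    induction x using UniformSpace.Completion.induction_on with
    | hp => exact isClosed_eq (M.action 0).continuous continuous_id
    | ih φ =>
      refine (M.action_coe 0 (M.toPre.symm φ)).trans ?_
      congr 2
      refine BoundedContinuousFunction.ext fun x => ?_
      change M.toPre.symm φ (x + 0) = M.toPre.symm φ x
      rw [add_zero]
  map_add g h x := by
    induction x using UniformSpace.Completion.induction_on with
    | hp =>
      exact isClosed_eq (M.action _).continuous
        ((M.action g).continuous.comp (M.action h).continuous)
    | ih φ =>
      refine (M.action_coe (g + h) (M.toPre.symm φ)).trans ?_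
      refine Eq.trans ?_ (congrArg (M.action g) (M.action_coe h (M.toPre.symm φ))).symm
      rw [action_coe]
      congr 2
      refine BoundedContinuousFunction.ext fun x => ?_
      simp [add_assoc]
  norm_map g x := by
    induction x using UniformSpace.Completion.induction_on with
    | hp => exact isClosed_eq (M.action g).continuous.norm continuous_norm
    | ih φ =>
      rw [UniformSpace.Completion.norm_coe, ← M.norm_translatePre g φ]
      exact (congrArg norm (M.action_coe g (M.toPre.symm φ))).trans
        (UniformSpace.Completion.norm_coe _)

end InvariantMean

variable [DecidableEq G]

/-- The two sums differ only over the symmetric difference of `s` and its translate, whose halves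
have equal size. This bound makes limits of averages along a Følner sequence invariant. -/
theorem abs_finsetAverage_translate_sub_le (s : Finset G) (φ : G →ᵇ ℝ) (g : G) :
    |finsetAverage s (translateFun g φ) - finsetAverage s φ| ≤
      2 * ‖φ‖ * (((s \ s.map (addRightEmbedding g)).card : ℝ) / s.card) := by
  set t := s.map (addRightEmbedding g) with ht
  have hcard : (t \ s).card = (s \ t).card :=
    Finset.card_sdiff_comm (by rw [ht, Finset.card_map])
  have hb : ∀ u : Finset G, |∑ x ∈ u, φ x| ≤ u.card * ‖φ‖ := fun u =>
    (Finset.abs_sum_le_sum_abs _ _).trans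
      ((Finset.sum_le_sum fun x _ => φ.norm_coe_le_norm x).trans_eq (by simp))
  have h1 : ∑ x ∈ s, translateFun g φ x = ∑ x ∈ t, φ x := by
    rw [ht, Finset.sum_map]; rfl
  rw [finsetAverage, finsetAverage, h1, ← mul_sub, abs_mul, abs_of_nonneg (by positivity),
    ← Finset.sum_sdiff_sub_sum_sdiff]
  have h2 : |∑ x ∈ t \ s, φ x - ∑ x ∈ s \ t, φ x| ≤ 2 * ‖φ‖ * (s \ t).card := by
    refine (abs_sub _ _).trans ?_
    have h3 := hb (t \ s)
    have h4 := hb (s \ t)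
    rw [hcard] at h3
    linarith
  calc _ ≤ (s.card : ℝ)⁻¹ * (2 * ‖φ‖ * (s \ t).card) := by gcongr
    _ = _ := by ring

/-- A Følner sequence yields an invariant mean, which is an ultrafilter limit of averages. -/
theorem exists_invariantMean (F : ℕ → Finset G)
    (hF : ∀ g, Tendsto (fun n => (((F n \ (F n).map (addRightEmbedding g)).card : ℝ) /
      (F n).card)) atTop (nhds 0)) :
    ∃ M : InvariantMean G, ∀ φ (δ : ℝ), (∀ n, δ ≤ finsetAverage (F n) φ) → δ ≤ M.toLinearMap φ := by
  set U : Ultrafilter ℕ := hyperfilter ℕ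
  have hlim : ∀ φ, ∃ a, Tendsto (fun n => finsetAverage (F n) φ) U (nhds a) := by
    intro φ
    obtain ⟨a, -, ha⟩ := (isCompact_Icc (a := -‖φ‖) (b := ‖φ‖)).ultrafilter_le_nhds
      (U.map fun n => finsetAverage (F n) φ) (by
        rw [le_principal_iff]
        exact Filter.mem_map.2 (Eventually.of_forall fun n =>
          abs_le.1 (abs_finsetAverage_le (F n) φ)))
    exact ⟨a, ha⟩
  choose m hm using hlim
  refine ⟨⟨⟨⟨m, fun φ ψ => ?_⟩, fun a φ => ?_⟩, fun φ => ?_, fun g φ => ?_⟩, fun φ δ h => ?_⟩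
  · refine tendsto_nhds_unique (hm (φ + ψ)) (((hm φ).add (hm ψ)).congr fun n => ?_)
    simp [finsetAverage, Finset.sum_add_distrib, mul_add]
  · refine tendsto_nhds_unique (hm (a • φ)) (((hm φ).const_mul a).congr fun n => ?_)
    simp [finsetAverage, ← Finset.mul_sum]
    ring
  · refine ge_of_tendsto' (hm (φ * φ)) fun n => ?_
    exact mul_nonneg (by positivity) (Finset.sum_nonneg fun x _ => mul_self_nonneg (φ x))
  · refine tendsto_nhds_unique (hm (translateFun g φ)) ?_
    have h0 : Tendsto (fun n => finsetAverage (F n) (translateFun g φ) - finsetAverage (F n) φ) U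
        (nhds 0) := by
      refine squeeze_zero_norm
        (fun n => abs_finsetAverage_translate_sub_le (F n) φ g) ?_
      simpa using ((hF g).const_mul (2 * ‖φ‖)).mono_left Nat.hyperfilter_le_atTop
    simpa using h0.add (hm φ)
  · exact ge_of_tendsto' (hm φ) h

/-- A set of positive density along a Følner sequence gives an isometric action on a Hilbert space
whose positive correlations detect the differences of the set. -/
theorem exists_isIsometricAction (F : ℕ → Finset G)
    (hF : ∀ g, Tendsto (fun n => (((F n \ (F n).map (addRightEmbedding g)).card : ℝ) /
      (F n).card)) atTop (nhds 0))
    (B : Set G) [DecidablePred (· ∈ B)] {δ : ℝ} (hδ : 0 < δ)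
    (hB : ∀ n, δ ≤ ((F n).card : ℝ)⁻¹ * ((F n).filter (· ∈ B)).card) :
    ∃ (M : InvariantMean G) (f e : M.Space), (∀ g, M.action g e = e) ∧ ⟪f, e⟫ ≠ 0 ∧
      ∀ g, 0 < ⟪f, M.action g f⟫ → g ∈ B - B := by
  obtain ⟨M, hM⟩ := exists_invariantMean F hF
  set φ : G →ᵇ ℝ := BoundedContinuousFunction.ofNormedAddCommGroup (B.indicator 1)
    continuous_of_discreteTopology 1 (fun x => by
      by_cases hx : x ∈ B <;> simp [hx]) with hφ
  have hφx : ∀ x, φ x = B.indicator 1 x := fun x => rfl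
  -- The vectors are the indicator function of `B` and the constant `1`; their inner product is the
  -- mean of `B`, which is at least `δ`.
  refine ⟨M, M.toPre φ, M.toPre 1, fun g => ?_, ?_, fun g hg => ?_⟩
  · rw [M.action_coe]
    rfl
  · rw [UniformSpace.Completion.inner_coe, M.inner_toPre, mul_one]
    refine (hδ.trans_le (hM φ δ fun n => (hB n).trans_eq ?_)).ne'
    rw [finsetAverage]
    congr 1
    simp only [hφx, Set.indicator_apply, Pi.one_apply]
    rw [Finset.sum_ite]
    simp
  · rw [M.action_coe, UniformSpace.Completion.inner_coe, M.inner_toPre] at hg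
    by_contra hgB
    refine hg.ne' ?_
    -- If `g` is not a difference of elements of `B`, the indicator of `B` and its translate have
    -- product zero.
    convert map_zero M.toLinearMap
    ext x
    simp only [BoundedContinuousFunction.mul_apply, translateFun_apply, hφx,
      BoundedContinuousFunction.coe_zero, Pi.zero_apply, Set.indicator_apply, Pi.one_apply]
    by_cases h1 : x ∈ B <;> by_cases h2 : x + g ∈ B <;> simp [h1, h2]
    exact hgB ⟨x + g, h2, x, h1, by simp⟩

end Mean

/-! ### From upper Banach density to Følner sequences of cubes. -/

section Density

variable {ι : Type*} [Fintype ι] [DecidableEq ι]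

/-- The cube `x + [0, N)^ι` as a finite set. -/
noncomputable def cubeFinset (x : ι → ℤ) (N : ℕ) : Finset (ι → ℤ) :=
  Fintype.piFinset fun i => Finset.Ico (x i) (x i + N)

theorem card_cubeFinset (x : ι → ℤ) (N : ℕ) : (cubeFinset x N).card = N ^ Fintype.card ι := by
  simp [cubeFinset]

/-- The cube shrunk by `C` on every side lies in both the cube and its translate by `g`. -/
theorem card_cubeFinset_sdiff_le (x g : ι → ℤ) (N : ℕ) {C : ℕ} (hC : ∀ i, |g i| ≤ C)
    (hN : 2 * C ≤ N) :
    (((cubeFinset x N) \ (cubeFinset x N).map (addRightEmbedding g)).card : ℝ) ≤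
      (N : ℝ) ^ Fintype.card ι - ((N : ℝ) - 2 * C) ^ Fintype.card ι := by
  set s := cubeFinset x N
  set t := cubeFinset (fun i => x i + C) (N - 2 * C)
  have hts : t ⊆ s := by
    intro v hv
    simp only [t, s, cubeFinset, Fintype.mem_piFinset, Finset.mem_Ico] at hv ⊢
    intro i
    have := hv i
    omega
  have htm : t ⊆ s.map (addRightEmbedding g) := by
    intro v hv
    refine Finset.mem_map.2 ⟨v - g, ?_, by simp⟩
    simp only [t, s, cubeFinset, Fintype.mem_piFinset, Finset.mem_Ico, Pi.sub_apply] at hv ⊢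
    intro i
    have := hv i
    have := abs_le.1 (hC i)
    omega
  have h1 : s \ s.map (addRightEmbedding g) ⊆ s \ t := Finset.sdiff_subset_sdiff le_rfl htm
  have h2 := Finset.card_le_card h1
  rw [Finset.card_sdiff_of_subset hts] at h2
  have h3 := Finset.card_le_card hts
  have h4 : ((s.card - t.card : ℕ) : ℝ) = (N : ℝ) ^ Fintype.card ι -
      ((N : ℝ) - 2 * C) ^ Fintype.card ι := by
    rw [Nat.cast_sub h3, card_cubeFinset, card_cubeFinset, Nat.cast_pow, Nat.cast_pow,
      Nat.cast_sub hN]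
    push_cast
    rfl
  rw [← h4]
  exact_mod_cast h2

theorem tendsto_card_cubeFinset_sdiff (x : ℕ → ι → ℤ) (N : ℕ → ℕ) (hN : Tendsto N atTop atTop)
    (g : ι → ℤ) :
    Tendsto (fun n => (((cubeFinset (x n) (N n) \
      (cubeFinset (x n) (N n)).map (addRightEmbedding g)).card : ℝ) /
      (cubeFinset (x n) (N n)).card)) atTop (nhds 0) := by
  obtain ⟨C, hC⟩ : ∃ C : ℕ, ∀ i, |g i| ≤ C := by
    refine ⟨∑ i, (g i).natAbs, fun i => ?_⟩
    rw [Int.abs_eq_natAbs]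
    exact_mod_cast Finset.single_le_sum (f := fun i => (g i).natAbs)
      (fun _ _ => Nat.zero_le _) (Finset.mem_univ i)
  have hNr : Tendsto (fun n => (N n : ℝ)) atTop atTop := tendsto_natCast_atTop_atTop.comp hN
  have hlim : Tendsto (fun n => 1 - (1 - 2 * C / (N n : ℝ)) ^ Fintype.card ι) atTop (nhds 0) := by
    have h1 : Tendsto (fun n => 2 * C / (N n : ℝ)) atTop (nhds 0) := hNr.const_div_atTop _
    simpa using ((h1.const_sub 1).pow (Fintype.card ι)).const_sub 1
  refine squeeze_zero' (Eventually.of_forall fun n => by positivity) ?_ hlim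
  filter_upwards [hN.eventually_ge_atTop (2 * C + 1)] with n hn
  have hpos : (0 : ℝ) < N n := by exact_mod_cast (by omega : 0 < N n)
  rw [card_cubeFinset, Nat.cast_pow, div_le_iff₀ (by positivity), sub_mul, one_mul, ← mul_pow]
  have : (1 - 2 * C / (N n : ℝ)) * N n = N n - 2 * C := by field_simp
  rw [this]
  exact card_cubeFinset_sdiff_le (x n) g (N n) hC (by omega)

/-- A set of positive upper Banach density has positive density along a sequence of integral
cubes whose side lengths tend to infinity. -/
theorem exists_cubeFinset_of_upperBanachDensity_pos (B : Set (ι → ℤ)) [DecidablePred (· ∈ B)]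
    (hB : 0 < upperBanachDensity B) :
    ∃ (x : ℕ → ι → ℤ) (N : ℕ → ℕ) (δ : ℝ), 0 < δ ∧ Tendsto N atTop atTop ∧
      ∀ n, δ ≤ ((cubeFinset (x n) (N n)).card : ℝ)⁻¹ *
        ((cubeFinset (x n) (N n)).filter (· ∈ B)).card := by
  obtain ⟨δ, hδ0, hδ⟩ := exists_between hB
  have hδtop : δ ≠ ⊤ := ne_top_of_lt hδ
  have hδr : 0 < δ.toReal := ENNReal.toReal_pos hδ0.ne' hδtop
  have hfreq := frequently_lt_of_lt_limsup (by isBoundedDefault) hδ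
  -- Rounding the side `R` up to `⌈R⌉₊` costs the factor `2 ^ d`: `R ≥ n + 1 ≥ 1` gives `⌈R⌉₊ ≤ 2 *
  -- R`.
  have hex : ∀ n : ℕ, ∃ (x : ι → ℤ) (N : ℕ), n ≤ N ∧ δ.toReal / 2 ^ Fintype.card ι ≤
      ((cubeFinset x N).card : ℝ)⁻¹ * ((cubeFinset x N).filter (· ∈ B)).card := by
    intro n
    obtain ⟨R, hR, hnR⟩ := (hfreq.and_eventually (eventually_ge_atTop ((n : ℝ) + 1))).exists
    obtain ⟨x, hx⟩ := lt_iSup_iff.1 hR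
    have hR1 : 1 ≤ R := by linarith [n.cast_nonneg (α := ℝ)]
    have hRN : R ≤ ⌈R⌉₊ := Nat.le_ceil R
    have hNR : (⌈R⌉₊ : ℝ) < R + 1 := Nat.ceil_lt_add_one (by linarith)
    have hsub : B ∩ intCube x R ⊆ ((cubeFinset x ⌈R⌉₊).filter (· ∈ B) : Finset (ι → ℤ)) := by
      rintro v ⟨hvB, hv⟩
      simp only [Finset.coe_filter, Set.mem_ofPred_eq, cubeFinset, Fintype.mem_piFinset,
        Finset.mem_Ico]
      refine ⟨fun i => ⟨by exact_mod_cast (hv i).1, ?_⟩, hvB⟩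
      have h := (hv i).2.trans_le (add_le_add_right hRN _)
      exact_mod_cast h
    have hcard : ((B ∩ intCube x R).encard : ℝ≥0∞) ≤
        (((cubeFinset x ⌈R⌉₊).filter (· ∈ B)).card : ℝ≥0∞) := by
      have := Set.encard_le_encard hsub
      rw [Set.encard_coe_eq_coe_finsetCard] at this
      exact_mod_cast ENat.toENNReal_le.2 this
    have h1 := (ENNReal.mul_lt_of_lt_div hx).le.trans hcard
    have h2 := ENNReal.toReal_mono (by simp) h1
    rw [ENNReal.toReal_mul, ENNReal.toReal_pow, ENNReal.toReal_ofReal (by linarith),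
      ENNReal.toReal_natCast] at h2
    refine ⟨x, ⌈R⌉₊, ?_, ?_⟩
    · have : (n : ℝ) ≤ ⌈R⌉₊ := by linarith
      exact_mod_cast this
    · have hpos : (0 : ℝ) < ⌈R⌉₊ := by linarith
      rw [card_cubeFinset, Nat.cast_pow, le_inv_mul_iff₀ (by positivity)]
      refine le_trans ?_ h2
      have h3 : ((⌈R⌉₊ : ℝ) / 2) ^ Fintype.card ι ≤ R ^ Fintype.card ι :=
        pow_le_pow_left₀ (by positivity) (by linarith) _
      rw [div_pow] at h3
      calc _ = δ.toReal * ((⌈R⌉₊ : ℝ) ^ Fintype.card ι / 2 ^ Fintype.card ι) := by ring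
        _ ≤ _ := by gcongr
  choose x N hN hd using hex
  exact ⟨x, N, _, by positivity, tendsto_atTop_mono hN tendsto_id, hd⟩

/-- A set of positive upper Banach density in `ℤ^ι` gives an isometric action on a Hilbert space
whose positive correlations detect the differences of the set. -/
theorem exists_isIsometricAction_of_upperBanachDensity_pos {B : Set (ι → ℤ)}
    (hB : 0 < upperBanachDensity B) :
    ∃ (M : InvariantMean (ι → ℤ)) (f e : M.Space), (∀ g, M.action g e = e) ∧ inner ℝ f e ≠ 0 ∧
      ∀ g, 0 < inner ℝ f (M.action g f) → g ∈ B - B := by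
  classical
  obtain ⟨x, N, δ, hδ, hN, hd⟩ := exists_cubeFinset_of_upperBanachDensity_pos B hB
  exact exists_isIsometricAction (fun n => cubeFinset (x n) (N n))
    (tendsto_card_cubeFinset_sdiff x N hN) B hδ hd

end Density

/-! ### Eichler transvections. -/

section Eichler

/-- A matrix `1 + N` with `N` nilpotent has determinant one. -/
theorem det_one_add_of_isNilpotent {ι R : Type*} [Fintype ι] [DecidableEq ι] [CommRing R]
    [IsDomain R] {N : Matrix ι ι R} (hN : IsNilpotent N) : (1 + N).det = 1 := by
  -- Over a domain the characteristic polynomial of `N` is a power of `X`; its value at `-1` is the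
  -- determinant up to sign.
  have h := sub_eq_zero.1 (Matrix.isNilpotent_charpoly_sub_pow_of_isNilpotent hN).eq_zero
  have h1 := congrArg (Polynomial.eval (-1)) h
  rw [Matrix.eval_charpoly, Polynomial.eval_pow, Polynomial.eval_X] at h1
  have h2 : Matrix.scalar ι (-1 : R) - N = -(1 + N) := by
    rw [map_neg, map_one]; abel
  rw [h2, Matrix.det_neg] at h1
  have h3 : ((-1 : R) ^ Fintype.card ι) * (-1) ^ Fintype.card ι = 1 := by
    rw [← mul_pow]; simp
  linear_combination (-1) ^ Fintype.card ι * h1 + (1 - (1 + N).det) * h3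

variable {ι R : Type*} [Fintype ι] [CommRing R]

/-- The nilpotent part of the Eichler transvection attached to the vectors `e` and `g` and the
diagonal quadratic form with coefficients `ε`. -/
def eichlerNilpotent (ε e g : ι → R) : Matrix ι ι R :=
  (2 : R) • Matrix.vecMulVec g (ε * e) - (2 : R) • Matrix.vecMulVec e (ε * g) -
    (2 * ((ε * g) ⬝ᵥ g)) • Matrix.vecMulVec e (ε * e)

/-- With the polar form `B` of `Q`, this is `v ↦ B(e,v) g - B(g,v) e - Q(g) B(e,v) e`; the factors
`2` come from polarization. -/
theorem eichlerNilpotent_mulVec (ε e g v : ι → R) :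
    eichlerNilpotent ε e g *ᵥ v = (2 * ((ε * e) ⬝ᵥ v)) • g - (2 * ((ε * g) ⬝ᵥ v)) • e -
      (2 * ((ε * g) ⬝ᵥ g) * ((ε * e) ⬝ᵥ v)) • e := by
  simp only [eichlerNilpotent, Matrix.sub_mulVec, Matrix.smul_mulVec, Matrix.vecMulVec_mulVec,
    op_smul_eq_smul, smul_smul]

theorem mul_dotProduct_comm (ε v w : ι → R) : (ε * v) ⬝ᵥ w = (ε * w) ⬝ᵥ v := by
  simp only [dotProduct, Pi.mul_apply]
  exact Finset.sum_congr rfl fun i _ => by ring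

/-- The square maps into the line of `e`, which the operator kills. This gives nilpotency, and it
extracts `e` from any `v` not orthogonal to it when `g` is anisotropic. -/
theorem eichlerNilpotent_mulVec_mulVec {ε e g : ι → R} (hee : (ε * e) ⬝ᵥ e = 0)
    (heg : (ε * e) ⬝ᵥ g = 0) (v : ι → R) :
    eichlerNilpotent ε e g *ᵥ (eichlerNilpotent ε e g *ᵥ v) =
      (-4 * ((ε * g) ⬝ᵥ g) * ((ε * e) ⬝ᵥ v)) • e := by
  have hge : (ε * g) ⬝ᵥ e = 0 := by rw [mul_dotProduct_comm, heg]
  rw [eichlerNilpotent_mulVec, eichlerNilpotent_mulVec ε e g v]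
  simp only [dotProduct_sub, dotProduct_smul, hee, heg, hge, smul_eq_mul]
  module

theorem eichlerNilpotent_map {S : Type*} [CommRing S] (φ : R →+* S) (ε e g : ι → R) :
    (eichlerNilpotent ε e g).map φ = eichlerNilpotent (φ ∘ ε) (φ ∘ e) (φ ∘ g) := by
  ext i j
  have h2 : φ 2 = 2 := map_ofNat φ 2
  simp [h2, eichlerNilpotent, Matrix.vecMulVec_apply, dotProduct]

variable [DecidableEq ι]

theorem isNilpotent_eichlerNilpotent {ε e g : ι → R} (hee : (ε * e) ⬝ᵥ e = 0)
    (heg : (ε * e) ⬝ᵥ g = 0) : IsNilpotent (eichlerNilpotent ε e g) := by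
  refine ⟨3, Matrix.ext_of_mulVec_single fun i => ?_⟩
  rw [pow_succ', pow_two, ← Matrix.mulVec_mulVec, ← Matrix.mulVec_mulVec,
    eichlerNilpotent_mulVec_mulVec hee heg, eichlerNilpotent_mulVec]
  rw [Matrix.zero_mulVec]
  simp [dotProduct_sub, hee, heg]

theorem dotProduct_one_add_eichlerNilpotent {ε e g : ι → R} (hee : (ε * e) ⬝ᵥ e = 0)
    (heg : (ε * e) ⬝ᵥ g = 0) (v : ι → R) :
    (ε * ((1 + eichlerNilpotent ε e g) *ᵥ v)) ⬝ᵥ ((1 + eichlerNilpotent ε e g) *ᵥ v) =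
      (ε * v) ⬝ᵥ v := by
  have hge : (ε * g) ⬝ᵥ e = 0 := by rw [mul_dotProduct_comm, heg]
  rw [Matrix.add_mulVec, Matrix.one_mulVec, eichlerNilpotent_mulVec]
  simp only [mul_add, mul_sub, mul_smul_comm, add_dotProduct, sub_dotProduct, smul_dotProduct,
    dotProduct_add, dotProduct_sub, dotProduct_smul, hee, heg, hge, smul_eq_mul,
    mul_dotProduct_comm ε v]
  ring

end Eichler

/-! ### Irreducibility of the group generated by the transvections. -/

section Irreducible

variable {p q : ℕ}

/-- The diagonal coefficients of `stdForm p q`. -/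
def stdSign (R : Type*) [Ring R] (p q : ℕ) : Fin p ⊕ Fin q → R :=
  Sum.elim (fun _ => 1) (fun _ => -1)

theorem stdForm_eq_dotProduct (v : Fin p ⊕ Fin q → ℤ) :
    stdForm p q v = (stdSign ℤ p q * v) ⬝ᵥ v := by
  rw [stdForm_apply]
  simp [stdSign, dotProduct, Fintype.sum_sum_type, sq, sub_eq_add_neg]

/-- The isotropic vector `x_i + y_j` or `x_i - y_j`. -/
def isotropicVector (R : Type*) [Ring R] (i : Fin p) (j : Fin q) (σ : ℤˣ) : Fin p ⊕ Fin q → R :=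
  Pi.single (Sum.inl i) 1 + Pi.single (Sum.inr j) ((σ : ℤ) : R)

theorem stdSign_mul_isotropicVector_dotProduct {R : Type*} [CommRing R] (i : Fin p) (j : Fin q)
    (σ : ℤˣ) (v : Fin p ⊕ Fin q → R) :
    (stdSign R p q * isotropicVector R i j σ) ⬝ᵥ v = v (Sum.inl i) - ((σ : ℤ) : R) * v (Sum.inr j) := by
  simp [stdSign, isotropicVector, dotProduct, Fintype.sum_sum_type, Pi.single_apply,
    sub_eq_add_neg]

theorem stdSign_mul_single_dotProduct {R : Type*} [CommRing R] (l : Fin p ⊕ Fin q)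
    (v : Fin p ⊕ Fin q → R) :
    (stdSign R p q * Pi.single l 1) ⬝ᵥ v = stdSign R p q l * v l := by
  simp [dotProduct, Pi.single_apply]

theorem isotropicVector_isotropic {R : Type*} [CommRing R] (i : Fin p) (j : Fin q) (σ : ℤˣ) :
    (stdSign R p q * isotropicVector R i j σ) ⬝ᵥ isotropicVector R i j σ = 0 := by
  rw [stdSign_mul_isotropicVector_dotProduct]
  have h : ((σ : ℤ) : R) * ((σ : ℤ) : R) = 1 := by
    rw [← Int.cast_mul, ← Units.val_mul, Int.units_mul_self]; simp
  simp [isotropicVector, h]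

theorem isotropicVector_orthogonal {R : Type*} [CommRing R] {i : Fin p} {j : Fin q} {σ : ℤˣ}
    {l : Fin p ⊕ Fin q} (hi : l ≠ Sum.inl i) (hj : l ≠ Sum.inr j) :
    (stdSign R p q * isotropicVector R i j σ) ⬝ᵥ Pi.single l 1 = 0 := by
  rw [stdSign_mul_isotropicVector_dotProduct]
  simp [hi.symm, hj.symm]

/-- The Eichler transvections attached to an isotropic vector `x_i ± y_j` and another basis
vector. -/
def eichlerSet (p q : ℕ) : Set (Matrix.SpecialLinearGroup (Fin p ⊕ Fin q) ℤ) :=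
  {γ | ∃ i j σ l, l ≠ Sum.inl i ∧ l ≠ Sum.inr j ∧ (γ : Matrix (Fin p ⊕ Fin q) (Fin p ⊕ Fin q) ℤ) =
    1 + eichlerNilpotent (stdSign ℤ p q) (isotropicVector ℤ i j σ) (Pi.single l 1)}

theorem eichlerSet_finite (p q : ℕ) : (eichlerSet p q).Finite := by
  have h : (Set.range fun a : Fin p × Fin q × ℤˣ × (Fin p ⊕ Fin q) =>
      1 + eichlerNilpotent (stdSign ℤ p q) (isotropicVector ℤ a.1 a.2.1 a.2.2.1)
        (Pi.single a.2.2.2 1)).Finite := Set.finite_range _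
  refine (h.preimage (f := fun γ : Matrix.SpecialLinearGroup (Fin p ⊕ Fin q) ℤ =>
    (γ : Matrix (Fin p ⊕ Fin q) (Fin p ⊕ Fin q) ℤ)) Subtype.val_injective.injOn).subset ?_
  rintro γ ⟨i, j, σ, l, -, -, hγ⟩
  exact ⟨(i, j, σ, l), hγ.symm⟩

theorem isUnipotentMatrix_of_mem_eichlerSet {γ : Matrix.SpecialLinearGroup (Fin p ⊕ Fin q) ℤ}
    (hγ : γ ∈ eichlerSet p q) : IsUnipotentMatrix γ := by
  obtain ⟨i, j, σ, l, hi, hj, hγ⟩ := hγ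
  rw [IsUnipotentMatrix, hγ, add_sub_cancel_left]
  exact isNilpotent_eichlerNilpotent (isotropicVector_isotropic i j σ)
    (isotropicVector_orthogonal hi hj)

theorem eichlerSet_subset_integralSO : eichlerSet p q ⊆ integralSO (stdForm p q) := by
  rintro γ ⟨i, j, σ, l, hi, hj, hγ⟩ v
  rw [hγ, stdForm_eq_dotProduct, stdForm_eq_dotProduct]
  exact dotProduct_one_add_eichlerNilpotent (isotropicVector_isotropic i j σ)
    (isotropicVector_orthogonal hi hj) v

theorem realRep_apply_of_eichler {Γ : Subgroup (Matrix.SpecialLinearGroup (Fin p ⊕ Fin q) ℤ)}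
    (γ : Γ) {i : Fin p} {j : Fin q} {σ : ℤˣ} {l : Fin p ⊕ Fin q}
    (hγ : (γ.1 : Matrix (Fin p ⊕ Fin q) (Fin p ⊕ Fin q) ℤ) =
      1 + eichlerNilpotent (stdSign ℤ p q) (isotropicVector ℤ i j σ) (Pi.single l 1))
    (v : Fin p ⊕ Fin q → ℝ) :
    realRep Γ γ v = v +
      eichlerNilpotent (stdSign ℝ p q) (isotropicVector ℝ i j σ) (Pi.single l 1) *ᵥ v := by
  have h1 : (Int.castRingHom ℝ) ∘ stdSign ℤ p q = stdSign ℝ p q := by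
    ext a; rcases a with a | a <;> simp [stdSign]
  have h2 : (Int.castRingHom ℝ) ∘ isotropicVector ℤ i j σ = isotropicVector ℝ i j σ := by
    ext a; simp only [isotropicVector, Function.comp_apply, Pi.add_apply, Pi.single_apply]
    split_ifs <;> simp
  have h3 : (Int.castRingHom ℝ) ∘ (Pi.single l 1 : Fin p ⊕ Fin q → ℤ) = Pi.single l 1 := by
    ext a; simp only [Function.comp_apply, Pi.single_apply]; split_ifs <;> simp
  have h : (γ.1 : Matrix (Fin p ⊕ Fin q) (Fin p ⊕ Fin q) ℤ).map (Int.castRingHom ℝ) =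
      1 + eichlerNilpotent (stdSign ℝ p q) (isotropicVector ℝ i j σ) (Pi.single l 1) := by
    rw [hγ, Matrix.map_add _ (map_add _), eichlerNilpotent_map, h1, h2, h3,
      Matrix.map_one _ (map_zero _) (map_one _)]
  change (γ.1 : Matrix (Fin p ⊕ Fin q) (Fin p ⊕ Fin q) ℤ).map (Int.castRingHom ℝ) *ᵥ v = _
  rw [h, Matrix.add_mulVec, Matrix.one_mulVec]

theorem exists_mem_eichlerSet {i : Fin p} {j : Fin q} {σ : ℤˣ} {l : Fin p ⊕ Fin q}
    (hi : l ≠ Sum.inl i) (hj : l ≠ Sum.inr j) :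
    ∃ γ ∈ eichlerSet p q, (γ : Matrix (Fin p ⊕ Fin q) (Fin p ⊕ Fin q) ℤ) =
      1 + eichlerNilpotent (stdSign ℤ p q) (isotropicVector ℤ i j σ) (Pi.single l 1) :=
  ⟨⟨_, det_one_add_of_isNilpotent (isNilpotent_eichlerNilpotent (isotropicVector_isotropic i j σ)
    (isotropicVector_orthogonal hi hj))⟩, ⟨i, j, σ, l, hi, hj, rfl⟩, rfl⟩

/-- Applying `γ - 1` twice to `v` gives a nonzero multiple of the isotropic vector. A second
negative coordinate `j'`, available as `q ≥ 2`, supplies the anisotropic `g`. -/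
theorem isotropicVector_mem (hq : 2 ≤ q)
    (W : Subrepresentation (realRep (Subgroup.closure (eichlerSet p q))))
    {v : Fin p ⊕ Fin q → ℝ} (hv : v ∈ W.toSubmodule) {i : Fin p} {j : Fin q} {σ : ℤˣ}
    (h : v (Sum.inl i) ≠ ((σ : ℤ) : ℝ) * v (Sum.inr j)) :
    isotropicVector ℝ i j σ ∈ W.toSubmodule := by
  have : Nontrivial (Fin q) := Fin.nontrivial_iff_two_le.2 hq
  obtain ⟨j', hj'⟩ := exists_ne j
  have hi : (Sum.inr j' : Fin p ⊕ Fin q) ≠ Sum.inl i := by simp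
  have hj : (Sum.inr j' : Fin p ⊕ Fin q) ≠ Sum.inr j := by simpa using hj'
  obtain ⟨γ, hγ, hγe⟩ := exists_mem_eichlerSet (σ := σ) hi hj
  set N := eichlerNilpotent (stdSign ℝ p q) (isotropicVector ℝ i j σ) (Pi.single (Sum.inr j') 1)
    with hN
  have hstep : ∀ w ∈ W.toSubmodule, N *ᵥ w ∈ W.toSubmodule := by
    intro w hw
    have h1 := W.apply_mem_toSubmodule ⟨γ, Subgroup.subset_closure hγ⟩ hw
    rw [realRep_apply_of_eichler _ hγe] at h1
    simpa using W.toSubmodule.sub_mem h1 hw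
  have h2 := hstep _ (hstep _ hv)
  rw [hN, eichlerNilpotent_mulVec_mulVec (isotropicVector_isotropic i j σ)
    (isotropicVector_orthogonal hi hj), stdSign_mul_single_dotProduct,
    stdSign_mul_isotropicVector_dotProduct] at h2
  refine (W.toSubmodule.smul_mem_iff ?_).1 h2
  simpa [stdSign] using sub_ne_zero.2 h

theorem single_mem_of_isotropicVector_mem {W : Submodule ℝ (Fin p ⊕ Fin q → ℝ)} {i : Fin p}
    {j : Fin q} (h : ∀ σ, isotropicVector ℝ i j σ ∈ W) :
    Pi.single (Sum.inl i) 1 ∈ W ∧ Pi.single (Sum.inr j) 1 ∈ W := by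
  have h1 := h 1
  have h2 := h (-1)
  have h3 : (Pi.single (Sum.inl i) 1 : Fin p ⊕ Fin q → ℝ) =
      (2⁻¹ : ℝ) • (isotropicVector ℝ i j 1 + isotropicVector ℝ i j (-1)) := by
    ext a
    simp only [isotropicVector, Pi.add_apply, Pi.smul_apply, Pi.single_apply]
    split_ifs <;> norm_num
  have h4 : (Pi.single (Sum.inr j) 1 : Fin p ⊕ Fin q → ℝ) =
      (2⁻¹ : ℝ) • (isotropicVector ℝ i j 1 - isotropicVector ℝ i j (-1)) := by
    ext a
    simp only [isotropicVector, Pi.add_apply, Pi.sub_apply, Pi.smul_apply, Pi.single_apply]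
    split_ifs <;> norm_num
  rw [h3, h4]
  exact ⟨W.smul_mem _ (W.add_mem h1 h2), W.smul_mem _ (W.sub_mem h1 h2)⟩

theorem isIrreducible_realRep_closure_eichlerSet (hp : 1 ≤ p) (hq : 2 ≤ q) :
    (realRep (Subgroup.closure (eichlerSet p q))).IsIrreducible := by
  let i₀ : Fin p := ⟨0, hp⟩
  let j₀ : Fin q := ⟨0, by omega⟩
  have key : ∀ W : Subrepresentation (realRep (Subgroup.closure (eichlerSet p q))),
      ∀ v ∈ W.toSubmodule, v ≠ 0 → W.toSubmodule = ⊤ := by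
    intro W v hv hv0
    obtain ⟨i, j, σ, hne⟩ : ∃ (i : Fin p) (j : Fin q) (σ : ℤˣ),
        v (Sum.inl i) ≠ ((σ : ℤ) : ℝ) * v (Sum.inr j) := by
      by_contra! hcon
      have hz : ∀ i j, v (Sum.inl i) = 0 ∧ v (Sum.inr j) = 0 := by
        intro i j
        have h1 := hcon i j 1
        have h2 := hcon i j (-1)
        simp only [Units.val_one, Units.val_neg, Int.cast_one, Int.cast_neg, one_mul,
          neg_mul] at h1 h2
        exact ⟨by linarith, by linarith⟩
      refine hv0 (funext fun a => ?_)
      rcases a with a | a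
      · exact (hz a j₀).1
      · exact (hz i₀ a).2
    have hall : ∀ w ∈ W.toSubmodule, ∀ i j, (∀ σ : ℤˣ,
        w (Sum.inl i) ≠ ((σ : ℤ) : ℝ) * w (Sum.inr j)) →
        Pi.single (Sum.inl i) 1 ∈ W.toSubmodule ∧ Pi.single (Sum.inr j) 1 ∈ W.toSubmodule :=
      fun w hw i j h => single_mem_of_isotropicVector_mem fun σ => isotropicVector_mem hq W hw (h σ)
    have he := isotropicVector_mem hq W hv hne
    -- The vectors `x_i + y_j` and `x_i - y_j` are not orthogonal, so either one produces the other.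
    have hopp : isotropicVector ℝ i j (-σ) ∈ W.toSubmodule := by
      refine isotropicVector_mem hq W he ?_
      simp only [isotropicVector, Pi.add_apply, Pi.single_apply, reduceCtorEq, if_true, if_false]
      rcases Int.units_eq_one_or σ with rfl | rfl <;> norm_num
    have hij : Pi.single (Sum.inl i) 1 ∈ W.toSubmodule ∧
        Pi.single (Sum.inr j) 1 ∈ W.toSubmodule := by
      refine single_mem_of_isotropicVector_mem fun τ => ?_
      rcases Int.units_eq_one_or σ with rfl | rfl <;>
        rcases Int.units_eq_one_or τ with rfl | rfl <;> simpa using ‹_›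
    have hr : ∀ j', Pi.single (Sum.inr j') 1 ∈ W.toSubmodule := fun j' =>
      (hall _ hij.1 i j' fun τ => by simp).2
    have hl : ∀ i', Pi.single (Sum.inl i') 1 ∈ W.toSubmodule := fun i' =>
      (hall _ hij.2 i' j fun τ => by
        rcases Int.units_eq_one_or τ with rfl | rfl <;> simp).1
    refine Submodule.eq_top_iff'.2 fun w => ?_
    rw [pi_eq_sum_univ' w]
    refine W.toSubmodule.sum_mem fun a _ => W.toSubmodule.smul_mem _ ?_
    rcases a with a | a
    · exact hl a
    · exact hr a
  have hbot : (⊥ : Subrepresentation (realRep (Subgroup.closure (eichlerSet p q)))).toSubmodule =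
      ⊥ := rfl
  have htop : (⊤ : Subrepresentation (realRep (Subgroup.closure (eichlerSet p q)))).toSubmodule =
      ⊤ := rfl
  refine { exists_pair_ne := ⟨⊥, ⊤, fun h => ?_⟩, eq_bot_or_eq_top := fun W => ?_ }
  · have h1 := congrArg Subrepresentation.toSubmodule h
    rw [hbot, htop] at h1
    have h2 : (Pi.single (Sum.inl i₀) 1 : Fin p ⊕ Fin q → ℝ) ∈
        (⊥ : Submodule ℝ (Fin p ⊕ Fin q → ℝ)) := h1 ▸ Submodule.mem_top
    simp at h2
  · by_cases hW : W.toSubmodule = ⊥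
    · exact Or.inl (Subrepresentation.toSubmodule_injective (hW.trans hbot.symm))
    · obtain ⟨v, hv, hv0⟩ := Submodule.exists_mem_ne_zero_of_ne_bot hW
      exact Or.inr (Subrepresentation.toSubmodule_injective ((key W v hv hv0).trans htop.symm))

end Irreducible

/-! ### A ternary subform and quadratic curves in its level sets. -/

section HyperbolicSpace

/-- The embedding of `ℤ³` into `ℤ^(p+q)`, `p ≥ 1` and `q ≥ 2`, that pulls `stdForm` back to
`4 (u v - w ^ 2)`. -/
def hyperbolicEmbedding (p q : ℕ) : ℤ × ℤ × ℤ →+ (Fin (p + 1) ⊕ Fin (q + 2) → ℤ) where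
  toFun a := Sum.elim (Fin.cons (a.1 + a.2.2) 0)
    (Fin.cons (a.2.2 - a.1) (Fin.cons (2 * a.2.1) 0))
  map_zero' := by
    ext i
    rcases i with i | i
    · refine Fin.cases ?_ (fun i => ?_) i <;> simp
    · refine Fin.cases ?_ (fun i => ?_) i
      · simp
      · refine Fin.cases ?_ (fun i => ?_) i <;> simp
  map_add' a b := by
    ext i
    rcases i with i | i
    · refine Fin.cases ?_ (fun i => ?_) i
      · simp; ring
      · simp
    · refine Fin.cases ?_ (fun i => ?_) i
      · simp; ring
      · refine Fin.cases ?_ (fun i => ?_) i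
        · simp; ring
        · simp

theorem stdForm_hyperbolicEmbedding (p q : ℕ) (a : ℤ × ℤ × ℤ) :
    stdForm (p + 1) (q + 2) (hyperbolicEmbedding p q a) = 4 * (a.1 * a.2.2 - a.2.1 ^ 2) := by
  rw [stdForm_apply]
  simp [hyperbolicEmbedding, Fin.sum_univ_succ]
  ring

/-- Cramer's rule: `n` is the Vandermonde determinant of `i`, `j`, `l`. -/
theorem exists_smul_eq_of_veronese {i j l : ℕ} (hij : i ≠ j) (hil : i ≠ l) (hjl : j ≠ l) :
    ∃ n : ℤ, n ≠ 0 ∧ ∀ g : ℤ × ℤ × ℤ, ∃ α β γ : ℤ, n • g =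
      α • ((i : ℤ) ^ 2, (i : ℤ), (1 : ℤ)) + β • ((j : ℤ) ^ 2, (j : ℤ), (1 : ℤ)) +
        γ • ((l : ℤ) ^ 2, (l : ℤ), (1 : ℤ)) := by
  refine ⟨((i : ℤ) - j) * (i - l) * (j - l), ?_, ?_⟩
  · refine mul_ne_zero (mul_ne_zero ?_ ?_) ?_ <;> rw [sub_ne_zero] <;> exact_mod_cast ‹_›
  · rintro ⟨u, w, v⟩
    refine ⟨u * (j - l) - w * (j ^ 2 - l ^ 2) + v * (j ^ 2 * l - l ^ 2 * j),
      i ^ 2 * (w - l * v) - u * (i - l) + l ^ 2 * (i * v - w),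
      i ^ 2 * (j * v - w) - j ^ 2 * (i * v - w) + u * (i - j), ?_⟩
    simp only [Prod.smul_mk, Prod.mk_add_mk, smul_eq_mul, Prod.mk.injEq]
    refine ⟨?_, ?_, ?_⟩ <;> ring

/-- The values of `stdForm` on the differences of a set of positive upper Banach density contain a
nontrivial subgroup. -/
theorem exists_addSubgroup_subset_stdForm_image {p q : ℕ} {B : Set (Fin (p + 1) ⊕ Fin (q + 2) → ℤ)}
    (hB : 0 < upperBanachDensity B) :
    ∃ H : AddSubgroup ℤ, H ≠ ⊥ ∧ (H : Set ℤ) ⊆ stdForm (p + 1) (q + 2) '' (B - B) := by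
  obtain ⟨M, f, e, he, hfe, hdiff⟩ := exists_isIsometricAction_of_upperBanachDensity_pos hB
  have hT : IsIsometricAction fun g : ℤ × ℤ × ℤ => M.action (hyperbolicEmbedding p q g) :=
    { map_zero := fun x => by rw [map_zero, M.isIsometricAction_action.map_zero]
      map_add := fun g h x => by rw [map_add, M.isIsometricAction_action.map_add]
      norm_map := fun g x => M.isIsometricAction_action.norm_map _ x }
  obtain ⟨k, hk, hrec⟩ := exists_pos_inner_quadratic hT
    (c := fun s : ℕ => ((s : ℤ) ^ 2, (s : ℤ), (1 : ℤ)))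
    (fun _ _ _ => exists_smul_eq_of_veronese) (fun g => he _) hfe
  refine ⟨AddSubgroup.zmultiples (4 * k ^ 2), ?_, ?_⟩
  · rw [Ne, AddSubgroup.zmultiples_eq_bot]
    positivity
  · rintro _ ⟨n, rfl⟩
    -- In the order `(u, w, v)`, the points `(1, t, n + t²)` satisfy `uv - w² = n`. The shear `(u +
    -- 2sw + s²v, w + sv, v)` preserves the form and carries them to `a_s + t b_s + t² c_s`;
    -- dilation by `k` and the factor `4` of the embedding give the value `4k²n`.
    obtain ⟨s, t, hst⟩ := hrec (fun s => (1 + (s : ℤ) ^ 2 * n, s * n, n))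
      (fun s => (2 * (s : ℤ), 1, 0))
    refine ⟨_, hdiff _ hst, ?_⟩
    rw [stdForm_hyperbolicEmbedding]
    simp only [Prod.smul_mk, Prod.mk_add_mk]
    simp only [smul_eq_mul, nsmul_eq_mul]
    push_cast
    ring

end HyperbolicSpace

theorem proposition1p9 (p q : ℕ) (hp : 1 ≤ p) (hq : 2 ≤ q) :
    (∃ Γ : Subgroup (Matrix.SpecialLinearGroup (Fin p ⊕ Fin q) ℤ),
      Γ ≤ integralSO (stdForm p q) ∧
      (∃ S : Finset (Matrix.SpecialLinearGroup (Fin p ⊕ Fin q) ℤ),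
        (∀ γ ∈ S, IsUnipotentMatrix γ) ∧ Subgroup.closure (S : Set _) = Γ) ∧
      (realRep Γ).IsIrreducible) ∧
    ∀ B : Set (Fin p ⊕ Fin q → ℤ), 0 < upperBanachDensity B →
      ∃ H : AddSubgroup ℤ, H ≠ ⊥ ∧ (H : Set ℤ) ⊆ stdForm p q '' (B - B) := by
  refine ⟨⟨Subgroup.closure (eichlerSet p q),
    (Subgroup.closure_le _).2 eichlerSet_subset_integralSO,
    ⟨(eichlerSet_finite p q).toFinset, fun γ hγ => ?_, by rw [Set.Finite.coe_toFinset]⟩,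
    isIrreducible_realRep_closure_eichlerSet hp hq⟩, fun B hB => ?_⟩
  · exact isUnipotentMatrix_of_mem_eichlerSet ((eichlerSet_finite p q).mem_toFinset.1 hγ)
  · obtain ⟨p, rfl⟩ := Nat.exists_eq_add_of_le' hp
    obtain ⟨q, rfl⟩ := Nat.exists_eq_add_of_le' hq
    exact exists_addSubgroup_subset_stdForm_image hB
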